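/- Let $E$ be a (real) normed space with the following property: there are $\varepsilon>0$ and $M>0$ such that for every $n\in\mathbb{N}$ the ball of radius $M$ around zero in $E$ contains a sequence of non-empty closed convex subsets $K_1,K_2,\ldots,K_n$ such that, for all $i\ge 1$ and whenever the indices that occur are at most $n$, $K_{2i}\cup K_{2i+1}\subseteq K_i$, and $K_{2i}$ and $K_{2i+1}$ are at a distance at least $\varepsilon$ from each other. Then $E$ is not superreflexive. Here the ultrapower of $E$ along an ultrafilter $\xi$ on a set $A$ is the quotient of the space of bounded families $(x_a)_{a\in A}$ in $E$ by the kernel of the seminorm $\lim_{a\to\xi}\|x_a\|$, with the induced norm, and $E$ is superreflexive if every ultrapower of it that is a Banach space (that is, complete) is reflexive, meaning that the canonical map into its bidual is onto. -/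

import Mathlib

open Filter Topology
open scoped ENNReal

universe u v

namespace BanachUltrapower

/-- The space `ℓ^∞(A, E)` of bounded families in `E` indexed by `A`. It is a separate type (not
reducible to `lp`), because it carries below the seminorm `lim_{a → ξ} ‖x a‖` determined by
the ultrafilter `ξ`, instead of the supremum norm. -/
def BoundedFamily {A : Type v} (_ξ : Ultrafilter A) (E : Type u) [NormedAddCommGroup E] :
    Type (max u v) :=
  lp (fun _ : A => E) ∞

namespace BoundedFamily

variable {A : Type v} (ξ : Ultrafilter A) (E : Type u) [NormedAddCommGroup E]

noncomputable instance : AddCommGroup (BoundedFamily ξ E) :=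
  inferInstanceAs (AddCommGroup (lp (fun _ : A => E) ∞))

noncomputable instance [NormedSpace ℝ E] : Module ℝ (BoundedFamily ξ E) :=
  inferInstanceAs (Module ℝ (lp (fun _ : A => E) ∞))

variable {ξ E}

/-- The members of a bounded family. -/
def coord (x : BoundedFamily ξ E) : A → E := fun a => x.1 a

theorem coord_add (x y : BoundedFamily ξ E) : coord (x + y) = coord x + coord y := rfl

theorem coord_smul [NormedSpace ℝ E] (c : ℝ) (x : BoundedFamily ξ E) : coord (c • x) = c • coord x := rfl

theorem exists_bound (x : BoundedFamily ξ E) : ∃ C, ∀ a, ‖coord x a‖ ≤ C := by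
  obtain ⟨C, hC⟩ := memℓp_infty_iff.1 (lp.memℓp (p := ∞) (E := fun _ : A => E) x)
  exact ⟨C, fun a => hC ⟨a, rfl⟩⟩

/-- The seminorm of a bounded family is the limit of the norms of its members along `ξ`. -/
noncomputable instance : Norm (BoundedFamily ξ E) where
  norm x := limUnder (ξ : Filter A) (fun a => ‖coord x a‖)

/-- The limit that defines the seminorm exists. -/
theorem tendsto_norm (x : BoundedFamily ξ E) :
    Tendsto (fun a => ‖coord x a‖) (ξ : Filter A) (𝓝 ‖x‖) := by
  obtain ⟨C, hC⟩ := exists_bound x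
  have h : ((ξ.map (fun a => ‖coord x a‖) : Ultrafilter ℝ) : Filter ℝ) ≤
      𝓟 (Set.Icc 0 C) := by
    rw [le_principal_iff]
    exact Ultrafilter.mem_map.2 (univ_mem' (fun a => ⟨norm_nonneg _, hC a⟩))
  obtain ⟨l, -, hl⟩ := isCompact_Icc.ultrafilter_le_nhds _ h
  exact tendsto_nhds_limUnder ⟨l, hl⟩

theorem seminormCore [NormedSpace ℝ E] : SeminormedSpace.Core ℝ (BoundedFamily ξ E) where
  norm_nonneg x := ge_of_tendsto' (tendsto_norm x) (fun _ => norm_nonneg _)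
  norm_smul c x := by
    refine tendsto_nhds_unique (tendsto_norm (c • x)) ?_
    simpa [coord_smul, norm_smul] using (tendsto_norm x).const_mul ‖c‖
  norm_triangle x y :=
    le_of_tendsto_of_tendsto' (tendsto_norm (x + y)) ((tendsto_norm x).add (tendsto_norm y))
      (fun a => by simpa [coord_add] using norm_add_le (coord x a) (coord y a))

noncomputable instance [NormedSpace ℝ E] : SeminormedAddCommGroup (BoundedFamily ξ E) :=
  SeminormedAddCommGroup.ofCore seminormCore

noncomputable instance [NormedSpace ℝ E] : NormedSpace ℝ (BoundedFamily ξ E) where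
  norm_smul_le c x := (seminormCore.norm_smul c x).le

end BoundedFamily

/-- The ultrapower of the normed space `E` along the ultrafilter `ξ`: the metric quotient of the
space of bounded families under the seminorm `lim_{a → ξ} ‖x a‖`. -/
abbrev Ultrapower {A : Type v} (ξ : Ultrafilter A) (E : Type u) [NormedAddCommGroup E]
    [NormedSpace ℝ E] : Type (max u v) :=
  SeparationQuotient (BoundedFamily ξ E)

/-- A normed space is reflexive if the canonical map into its bidual is onto. -/
def IsReflexive (V : Type u) [NormedAddCommGroup V] [NormedSpace ℝ V] : Prop :=
  Function.Surjective (NormedSpace.inclusionInDoubleDual ℝ V)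

/-- A normed space is superreflexive if every Banach space ultrapower of it is reflexive. If `E` is
complete, then so are all its ultrapowers. For an incomplete `E`, the ultrapowers which are
not Banach spaces (for instance those along principal ultrafilters) are not considered. -/
def IsSuperreflexive (E : Type u) [NormedAddCommGroup E] [NormedSpace ℝ E] : Prop :=
  ∀ (A : Type v) (ξ : Ultrafilter A),
    CompleteSpace (Ultrapower ξ E) → IsReflexive (Ultrapower ξ E)

/-- `K 1, …, K n` are non-empty closed convex subsets of the closed `M`-ball around zero such that
`K (2 i)` and `K (2 i + 1)` are contained in `K i`, and are at a distance at least `ε` from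
each other, whenever the indices are in the range `1, …, n`. The other values of `K` are
irrelevant. -/
structure IsDyadicFamily {E : Type u} [NormedAddCommGroup E] [NormedSpace ℝ E]
    (ε M : ℝ) (n : ℕ) (K : ℕ → Set E) : Prop where
  nonempty : ∀ i, 1 ≤ i → i ≤ n → (K i).Nonempty
  isClosed : ∀ i, 1 ≤ i → i ≤ n → IsClosed (K i)
  convex : ∀ i, 1 ≤ i → i ≤ n → Convex ℝ (K i)
  subset_ball : ∀ i, 1 ≤ i → i ≤ n → K i ⊆ Metric.closedBall 0 M
  left_subset : ∀ i, 1 ≤ i → 2 * i ≤ n → K (2 * i) ⊆ K i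
  right_subset : ∀ i, 1 ≤ i → 2 * i + 1 ≤ n → K (2 * i + 1) ⊆ K i
  separated : ∀ i, 1 ≤ i → 2 * i + 1 ≤ n →
    ∀ x ∈ K (2 * i), ∀ y ∈ K (2 * i + 1), ε ≤ dist x y

end BanachUltrapower

/-!
Along a free ultrafilter on `ℕ` (lifted to the required universe), the ultrapower of any normed
space is complete, by a diagonal argument (`completeSpace_ultrapower`), so superreflexivity would
make it reflexive. The finite dyadic families in `E` induce an *infinite* dyadic tree in the
ultrapower: the `i`-th set consists of the classes of families which are eventually in the `i`-th
sets (`limitSet`).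

A reflexive space has no bounded infinite dyadic tree of convex sets `L i` with separation `ε > 0`
(`not_isReflexive_of_tree`). Choose a point `y i` in each `L i`. Along every branch
`σ : ℕ → Bool`, the chosen points have a weak cluster point `x σ` by reflexivity. By Hahn–Banach,
it belongs to the closure of every `L i` on the branch, so that different branches give points at
a distance at least `ε`. But it also belongs to the closed span of the countable set of all `y i`,
and a separable set has no uncountable `ε`-separated subset.
-/

namespace BanachUltrapower

/-! ### Dyadic trees in reflexive spaces -/

section Reflexive

variable {V : Type u} [NormedAddCommGroup V] [NormedSpace ℝ V]

/-- In a reflexive space, bounded sequences converge weakly along ultrafilters. This is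
Banach–Alaoglu in the bidual. -/
theorem IsReflexive.exists_weak_limit (hV : IsReflexive V) (U : Ultrafilter ℕ) {M : ℝ}
    {y : ℕ → V} (hy : ∀ n, ‖y n‖ ≤ M) :
    ∃ x : V, ∀ f : StrongDual ℝ V, Tendsto (fun n => f (y n)) U (𝓝 (f x)) := by
  let J : V → WeakDual ℝ (StrongDual ℝ V) := fun v =>
    StrongDual.toWeakDual (NormedSpace.inclusionInDoubleDual ℝ V v)
  have hmem : ∀ n, J (y n) ∈ WeakDual.toStrongDual ⁻¹'
      Metric.closedBall (0 : StrongDual ℝ (StrongDual ℝ V)) M := by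
    intro n
    refine mem_closedBall_zero_iff (E := StrongDual ℝ (StrongDual ℝ V)).2 ?_
    exact (NormedSpace.double_dual_bound ℝ V (y n)).trans (hy n)
  have hU : ((U.map (fun n => J (y n)) : Ultrafilter _) : Filter _) ≤
      𝓟 (WeakDual.toStrongDual ⁻¹' Metric.closedBall (0 : StrongDual ℝ (StrongDual ℝ V)) M) := by
    rw [le_principal_iff]
    exact Ultrafilter.mem_map.2 (univ_mem' hmem)
  obtain ⟨Φ, -, hΦ⟩ := (WeakDual.isCompact_closedBall
    (0 : StrongDual ℝ (StrongDual ℝ V)) M).ultrafilter_le_nhds _ hU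
  obtain ⟨x, hx⟩ := hV (WeakDual.toStrongDual Φ)
  refine ⟨x, fun f => ?_⟩
  have h1 : Tendsto (fun n => J (y n)) U (𝓝 Φ) := hΦ
  have h2 := ((WeakDual.eval_continuous f).tendsto Φ).comp h1
  have h3 : Φ f = f x := (DFunLike.congr_fun hx f).symm
  rw [← h3]
  exact h2

/-- Mazur: closed convex sets are closed under weak limits. -/
theorem mem_of_weak_limit {U : Filter ℕ} [U.NeBot] {y : ℕ → V} {x : V}
    (hx : ∀ f : StrongDual ℝ V, Tendsto (fun n => f (y n)) U (𝓝 (f x)))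
    {S : Set V} (hS : Convex ℝ S) (hS' : IsClosed S) (hy : ∀ᶠ n in U, y n ∈ S) : x ∈ S := by
  by_contra hxS
  obtain ⟨f, c, hf, hc⟩ := geometric_hahn_banach_closed_point hS hS' hxS
  exact hc.not_ge (le_of_tendsto (hx f) (hy.mono fun n hn => (hf _ hn).le))

/-- A separable set does not contain a family of `ε`-separated points indexed by an uncountable
type. -/
theorem not_separated_of_uncountable {X ι : Type*} [PseudoMetricSpace X] [Uncountable ι]
    {S : Set X} (hS : TopologicalSpace.IsSeparable S) {x : ι → X} (hx : ∀ i, x i ∈ S) {ε : ℝ}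
    (hε : 0 < ε) (hsep : ∀ i j, i ≠ j → ε ≤ dist (x i) (x j)) : False := by
  obtain ⟨D, hD, hSD⟩ := hS
  have h : ∀ i, ∃ d ∈ D, dist (x i) d < ε / 2 := fun i =>
    Metric.mem_closure_iff.1 (hSD (hx i)) _ (half_pos hε)
  choose d hdD hd using h
  have hinj : Function.Injective (fun i => (⟨d i, hdD i⟩ : D)) := by
    intro i j hij
    by_contra hne
    have hij' : d i = d j := congrArg Subtype.val hij
    have h1 := hsep i j hne
    have h2 := dist_triangle_right (x i) (x j) (d i)
    have h3 := hd i
    have h4 := hd j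
    rw [← hij'] at h4
    linarith
  have := hD.to_subtype
  exact not_countable hinj.countable

/-- The `n`-th vertex on the branch `σ` of the dyadic tree with root `1`, where the children
of `i` are `2 * i` and `2 * i + 1`. -/
def branchNode (σ : ℕ → Bool) : ℕ → ℕ
  | 0 => 1
  | n + 1 => 2 * branchNode σ n + (σ n).toNat

theorem one_le_branchNode (σ : ℕ → Bool) (n : ℕ) : 1 ≤ branchNode σ n := by
  induction n with
  | zero => exact le_rfl
  | succ n ih => simp only [branchNode]; omega

theorem branchNode_congr {σ τ : ℕ → Bool} {n : ℕ} (h : ∀ k < n, σ k = τ k) :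
    branchNode σ n = branchNode τ n := by
  induction n with
  | zero => rfl
  | succ n ih =>
    simp only [branchNode, h n n.lt_succ_self, ih fun k hk => h k (hk.trans n.lt_succ_self)]

/-- A reflexive space contains no infinite dyadic tree of non-empty convex sets which is bounded and
whose siblings are uniformly separated. -/
theorem not_isReflexive_of_tree {L : ℕ → Set V} {ε M : ℝ} (hε : 0 < ε)
    (hne : ∀ i, 1 ≤ i → (L i).Nonempty) (hconv : ∀ i, 1 ≤ i → Convex ℝ (L i))
    (hM : ∀ i, 1 ≤ i → ∀ x ∈ L i, ‖x‖ ≤ M)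
    (hleft : ∀ i, 1 ≤ i → L (2 * i) ⊆ L i) (hright : ∀ i, 1 ≤ i → L (2 * i + 1) ⊆ L i)
    (hsep : ∀ i, 1 ≤ i → ∀ x ∈ L (2 * i), ∀ y ∈ L (2 * i + 1), ε ≤ dist x y) :
    ¬ IsReflexive V := by
  intro hV
  choose! y hy using hne
  have hanti : ∀ σ : ℕ → Bool, Antitone (fun n => L (branchNode σ n)) := by
    refine fun σ => antitone_nat_of_succ_le fun n => ?_
    have hi := one_le_branchNode σ n
    cases hσ : σ n
    · simpa [branchNode, hσ] using hleft _ hi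
    · simpa [branchNode, hσ] using hright _ hi
  choose x hx using fun σ : ℕ → Bool => hV.exists_weak_limit (hyperfilter ℕ)
    (y := fun n => y (branchNode σ n))
    fun n => hM _ (one_le_branchNode σ n) _ (hy _ (one_le_branchNode σ n))
  have hxL : ∀ σ n, x σ ∈ closure (L (branchNode σ n)) := by
    intro σ n
    refine mem_of_weak_limit (hx σ) (hconv _ (one_le_branchNode σ n)).closure isClosed_closure ?_
    have hn : ∀ᶠ k in (hyperfilter ℕ : Filter ℕ), n ≤ k :=
      Nat.hyperfilter_le_atTop (eventually_ge_atTop n)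
    filter_upwards [hn] with k hk
    exact subset_closure (hanti σ hk (hy _ (one_le_branchNode σ k)))
  have hclosep : ∀ i, 1 ≤ i → ∀ u ∈ closure (L (2 * i)), ∀ v ∈ closure (L (2 * i + 1)),
      ε ≤ dist u v := by
    intro i hi u hu v hv
    have hclosed : IsClosed {p : V × V | ε ≤ dist p.1 p.2} :=
      isClosed_le continuous_const continuous_dist
    have hsub : L (2 * i) ×ˢ L (2 * i + 1) ⊆ {p : V × V | ε ≤ dist p.1 p.2} :=
      fun p hp => hsep i hi _ hp.1 _ hp.2
    have huv : (u, v) ∈ closure (L (2 * i) ×ˢ L (2 * i + 1)) := by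
      rw [closure_prod_eq]
      exact ⟨hu, hv⟩
    exact closure_minimal hsub hclosed huv
  have hxsep : ∀ σ τ, σ ≠ τ → ε ≤ dist (x σ) (x τ) := by
    intro σ τ hne
    have hex : ∃ n, σ n ≠ τ n := Function.ne_iff.1 hne
    -- The two branches separate at the children of the vertex `branchNode σ (Nat.find hex)`.
    have hnode : branchNode σ (Nat.find hex) = branchNode τ (Nat.find hex) :=
      branchNode_congr fun k hk => not_not.1 (Nat.find_min hex hk)
    have hdiff := Nat.find_spec hex
    have h1 := hxL σ (Nat.find hex + 1)
    have h2 := hxL τ (Nat.find hex + 1)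
    have hi := one_le_branchNode τ (Nat.find hex)
    simp only [branchNode, hnode] at h1 h2
    cases hσ : σ (Nat.find hex) <;> cases hτ : τ (Nat.find hex)
    · exact absurd (hσ.trans hτ.symm) hdiff
    · rw [hσ] at h1
      rw [hτ] at h2
      exact hclosep _ hi _ h1 _ h2
    · rw [hσ] at h1
      rw [hτ] at h2
      rw [dist_comm]
      exact hclosep _ hi _ h2 _ h1
    · exact absurd (hσ.trans hτ.symm) hdiff
  have hspan : ∀ σ, x σ ∈ closure (Submodule.span ℝ (Set.range y) : Set V) := fun σ =>
    mem_of_weak_limit (hx σ) (Submodule.span ℝ (Set.range y)).convex.closure isClosed_closure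
      (Eventually.of_forall fun n => subset_closure (Submodule.subset_span ⟨_, rfl⟩))
  have hsepble : TopologicalSpace.IsSeparable
      (closure (Submodule.span ℝ (Set.range y) : Set V)) :=
    ((Set.countable_range y).isSeparable.span).closure
  have : Uncountable (ℕ → Bool) := by
    rw [← not_countable_iff]
    intro hc
    obtain ⟨f, hf⟩ := exists_surjective_nat (ℕ → Bool)
    obtain ⟨n, hn⟩ := hf fun k => !(f k k)
    have := congrFun hn n
    simp at this
  exact not_separated_of_uncountable hsepble hspan hε hxsep

end Reflexive

/-! ### The ultrapower along a free ultrafilter -/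

section Ultrapower

variable {E : Type u} [NormedAddCommGroup E]

namespace BoundedFamily

variable {A : Type v} {ξ : Ultrafilter A}

/-- The bounded family with given members. -/
def ofBound (x : A → E) (C : ℝ) (hx : ∀ a, ‖x a‖ ≤ C) : BoundedFamily ξ E :=
  ⟨x, memℓp_infty ⟨C, by rintro _ ⟨a, rfl⟩; exact hx a⟩⟩

theorem tendsto_dist [NormedSpace ℝ E] (x y : BoundedFamily ξ E) :
    Tendsto (fun a => dist (coord x a) (coord y a)) ξ (𝓝 (dist x y)) := by
  have h : Tendsto (fun a => ‖coord x a - coord y a‖) ξ (𝓝 ‖x - y‖) := tendsto_norm (x - y)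
  simpa only [dist_eq_norm] using h

end BoundedFamily

open BoundedFamily

variable [NormedSpace ℝ E]

/-- The standard free ultrafilter on the natural numbers, lifted to a given universe. -/
noncomputable def freeUltrafilter : Ultrafilter (ULift.{v} ℕ) :=
  (hyperfilter ℕ).map ULift.up

theorem eventually_le_down (n : ℕ) :
    ∀ᶠ a in (freeUltrafilter.{v} : Filter (ULift.{v} ℕ)), n ≤ a.down := by
  have h : ∀ᶠ k in (hyperfilter ℕ : Filter ℕ), n ≤ k :=
    Nat.hyperfilter_le_atTop (eventually_ge_atTop n)
  exact h

/-- Ultrapowers along a free ultrafilter on `ℕ` are complete, even if `E` is not. -/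
theorem completeSpace_ultrapower : CompleteSpace (Ultrapower freeUltrafilter.{v} E) := by
  refine Metric.complete_of_convergent_controlled_sequences (fun n : ℕ => 1 / ((n : ℝ) + 1))
    (fun n => Nat.one_div_pos_of_nat) fun u hu => ?_
  choose x hx using fun n => SeparationQuotient.surjective_mk (u n)
  -- The diagonal family takes at `a` the value of the last `x k`, `k ≤ a`, up to which the
  -- Cauchy estimates are true at `a`.
  let P : ULift.{v} ℕ → ℕ → Prop := fun a k =>
    ∀ j ≤ k, ∀ i ≤ j, dist (coord (x i) a) (coord (x j) a) < 1 / ((i : ℝ) + 1)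
  classical
  let k : ULift.{v} ℕ → ℕ := fun a => Nat.findGreatest (P a) a.down
  have hP0 : ∀ a, P a 0 := by
    intro a j hj i hi
    obtain rfl : j = 0 := by omega
    obtain rfl : i = 0 := by omega
    simp
  have hPk : ∀ a, P a (k a) := fun a => Nat.findGreatest_spec (Nat.zero_le _) (hP0 a)
  obtain ⟨C, hC⟩ := exists_bound (x 0)
  have hbound : ∀ a, ‖coord (x (k a)) a‖ ≤ C + 1 := by
    intro a
    have h1 := hPk a (k a) le_rfl 0 (Nat.zero_le _)
    have h2 := norm_le_norm_add_norm_sub (coord (x 0) a) (coord (x (k a)) a)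
    rw [dist_eq_norm] at h1
    norm_num at h1
    linarith [hC a]
  let z : BoundedFamily freeUltrafilter.{v} E := ofBound (fun a => coord (x (k a)) a) (C + 1) hbound
  have hev : ∀ n, ∀ᶠ a in (freeUltrafilter.{v} : Filter (ULift.{v} ℕ)), n ≤ k a := by
    intro n
    have hPn : ∀ᶠ a in (freeUltrafilter.{v} : Filter (ULift.{v} ℕ)), P a n := by
      refine (Set.finite_Iic n).eventually_all.2 fun j _ =>
        (Set.finite_Iic j).eventually_all.2 fun i hi => ?_
      refine (tendsto_dist (x i) (x j)).eventually_lt_const ?_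
      have := hu i i j le_rfl hi
      rwa [← hx i, ← hx j, SeparationQuotient.dist_mk] at this
    filter_upwards [hPn, eventually_le_down n] with a ha hna
    exact Nat.le_findGreatest hna ha
  refine ⟨SeparationQuotient.mk z, tendsto_iff_dist_tendsto_zero.2 ?_⟩
  refine squeeze_zero (fun _ => dist_nonneg) (fun n => ?_) tendsto_one_div_add_atTop_nhds_zero_nat
  rw [← hx n, SeparationQuotient.dist_mk]
  refine le_of_tendsto (tendsto_dist (x n) z) ?_
  filter_upwards [hev n] with a ha
  exact (hPk a (k a) le_rfl n ha).le

/-- The set of the classes of the bounded families which are eventually in the given sets. -/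
def limitSet {A : Type v} (ξ : Ultrafilter A) (S : A → Set E) : Set (Ultrapower ξ E) :=
  {w | ∃ x : BoundedFamily ξ E, SeparationQuotient.mk x = w ∧
    ∀ᶠ a in (ξ : Filter A), coord x a ∈ S a}

variable {A : Type v} {ξ : Ultrafilter A} {S T : A → Set E}

theorem limitSet_mono (h : ∀ᶠ a in (ξ : Filter A), S a ⊆ T a) : limitSet ξ S ⊆ limitSet ξ T := by
  rintro _ ⟨x, rfl, hx⟩
  exact ⟨x, rfl, by filter_upwards [h, hx] with a h1 h2 using h1 h2⟩

theorem norm_le_of_mem_limitSet {M : ℝ}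
    (h : ∀ᶠ a in (ξ : Filter A), S a ⊆ Metric.closedBall 0 M) {w : Ultrapower ξ E}
    (hw : w ∈ limitSet ξ S) : ‖w‖ ≤ M := by
  obtain ⟨x, rfl, hx⟩ := hw
  rw [SeparationQuotient.norm_mk]
  refine le_of_tendsto (tendsto_norm x) ?_
  filter_upwards [h, hx] with a h1 h2 using mem_closedBall_zero_iff.1 (h1 h2)

theorem limitSet_nonempty {M : ℝ} (hM : 0 ≤ M)
    (h : ∀ᶠ a in (ξ : Filter A), S a ⊆ Metric.closedBall 0 M)
    (h' : ∀ᶠ a in (ξ : Filter A), (S a).Nonempty) : (limitSet ξ S).Nonempty := by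
  have hsel : ∀ a, ∃ y : E, ‖y‖ ≤ M ∧
      (S a ⊆ Metric.closedBall 0 M → (S a).Nonempty → y ∈ S a) := by
    intro a
    by_cases hS : S a ⊆ Metric.closedBall 0 M ∧ (S a).Nonempty
    · obtain ⟨y, hy⟩ := hS.2
      exact ⟨y, mem_closedBall_zero_iff.1 (hS.1 hy), fun _ _ => hy⟩
    · exact ⟨0, by simpa using hM, fun h1 h2 => absurd ⟨h1, h2⟩ hS⟩
  choose y hyM hyS using hsel
  refine ⟨_, ofBound y M hyM, rfl, ?_⟩
  filter_upwards [h, h'] with a h1 h2 using hyS a h1 h2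

theorem convex_limitSet (h : ∀ᶠ a in (ξ : Filter A), Convex ℝ (S a)) :
    Convex ℝ (limitSet ξ S) := by
  rintro _ ⟨x, rfl, hx⟩ _ ⟨y, rfl, hy⟩ s t hs ht hst
  refine ⟨s • x + t • y, rfl, ?_⟩
  filter_upwards [h, hx, hy] with a h1 h2 h3
  rw [coord_add, coord_smul, coord_smul]
  exact h1 h2 h3 hs ht hst

theorem le_dist_of_mem_limitSet {ε : ℝ}
    (h : ∀ᶠ a in (ξ : Filter A), ∀ x ∈ S a, ∀ y ∈ T a, ε ≤ dist x y) {w w' : Ultrapower ξ E}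
    (hw : w ∈ limitSet ξ S) (hw' : w' ∈ limitSet ξ T) : ε ≤ dist w w' := by
  obtain ⟨x, rfl, hx⟩ := hw
  obtain ⟨y, rfl, hy⟩ := hw'
  rw [SeparationQuotient.dist_mk]
  refine ge_of_tendsto (tendsto_dist x y) ?_
  filter_upwards [h, hx, hy] with a h1 h2 h3 using h1 _ h2 _ h3

end Ultrapower

end BanachUltrapower

open BanachUltrapower in
theorem corollaryc (E : Type u) [NormedAddCommGroup E] [NormedSpace ℝ E]
    (h : ∃ ε : ℝ, 0 < ε ∧ ∃ M : ℝ, 0 < M ∧ ∀ n : ℕ, ∃ K : ℕ → Set E,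
      BanachUltrapower.IsDyadicFamily ε M n K) :
    ¬ BanachUltrapower.IsSuperreflexive.{u, v} E := by
  obtain ⟨ε, hε, M, hM, hK⟩ := h
  choose K hK using hK
  intro hE
  have hball : ∀ i, 1 ≤ i → ∀ᶠ a in (freeUltrafilter.{v} : Filter (ULift.{v} ℕ)),
      K a.down i ⊆ Metric.closedBall 0 M := fun i hi =>
    (eventually_le_down i).mono fun a ha => (hK a.down).subset_ball i hi ha
  refine not_isReflexive_of_tree (L := fun i => limitSet freeUltrafilter.{v} fun a => K a.down i)
    (M := M) hε (fun i hi => ?_) (fun i hi => ?_) (fun i hi w hw => ?_) (fun i hi => ?_) (fun i hi => ?_)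
    (fun i hi w hw w' hw' => ?_) (hE _ freeUltrafilter.{v} completeSpace_ultrapower)
  · exact limitSet_nonempty hM.le (hball i hi)
      ((eventually_le_down i).mono fun a ha => (hK a.down).nonempty i hi ha)
  · exact convex_limitSet ((eventually_le_down i).mono fun a ha => (hK a.down).convex i hi ha)
  · exact norm_le_of_mem_limitSet (hball i hi) hw
  · exact limitSet_mono ((eventually_le_down _).mono fun a ha => (hK a.down).left_subset i hi ha)
  · exact limitSet_mono ((eventually_le_down _).mono fun a ha => (hK a.down).right_subset i hi ha)
  · exact le_dist_of_mem_limitSet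
      ((eventually_le_down _).mono fun a ha => (hK a.down).separated i hi ha) hw hw'
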